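/- Let $AP$ be a non-empty set of atomic propositions. LTL formulas (in positive normal form) are given by $\varphi ::= a \mid \neg a \mid \varphi\wedge\varphi \mid \varphi\vee\varphi \mid \mathsf X\varphi \mid \varphi\,\mathsf U\,\varphi \mid \varphi\,\mathsf W\,\varphi$ with $a\in AP$, and are interpreted over infinite words $\rho\in(2^{AP})^\omega$ in the usual way. Abbreviations: $\top = a\vee\neg a$ and $\bot = a\wedge\neg a$ for a fixed $a \in AP$, $\mathsf F\varphi=\top\,\mathsf U\,\varphi$, $\mathsf G\varphi=\varphi\,\mathsf W\,\bot$. Write $\varphi\equiv\psi$ if $\varphi$ and $\psi$ are satisfied by the same infinite words. A formula $\varphi$ is *fair* if the set of words satisfying it is closed under taking suffixes and under prepending finite words. $\mathrm{LTL}(\mathsf F,\mathsf G)$ is the set of formulas built from $a,\neg a$ by $\wedge,\vee,\mathsf F,\mathsf G$; $\mathrm{LTL}(\mathsf U,\mathsf X)$ (co-safety formulas) is the set of those built from $a,\neg a$ by $\wedge,\vee,\mathsf X,\mathsf U$. **Theorem.** Let $\varphi$ be a fair LTL formula. Then there is a formula of the form $$\flat(\varphi)=\bigvee_{i=1}^m\Bigl(\varphi_{i0}\wedge\mathsf{FG}\,\varphi_{i1}\wedge\bigwedge_{j=2}^{n_i}\mathsf{GF}\,\varphi_{ij}\Bigr)$$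 with $\varphi_{i0}\in\mathrm{LTL}(\mathsf F,\mathsf G)$ and $\varphi_{ij}\in\mathrm{LTL}(\mathsf U,\mathsf X)$ for all $1\le i\le m$, $1\le j\le n_i$ (empty disjunctions and conjunctions being $\bot$ and $\top$), such that: 1. $\varphi\equiv\flat(\varphi)$; 2. all $\mathsf F$ and $\mathsf G$ modalities have been moved out of the scope of $\mathsf U$ and $\mathsf X$: no $\varphi_{ij}$ with $j\ge1$ has a subformula of the form $\mathsf F\chi$ or $\mathsf G\chi$; 3. the transformation is syntactic: $\flat(\varphi)$ is obtained from $\mathsf{GF}\varphi$ (which is equivalent to $\varphi$ by fairness) in finitely many steps, each of which replaces one occurrence of a subformula that is one side of an instance of one of the following equations by the other side (here $*\in\{\wedge,\vee\}$, $\mathsf M\in\{\mathsf F,\mathsf G\}$, and $\alpha,\beta,\gamma$ are arbitrary formulas): - commutativity and associativity of $\wedge$ and of $\vee$, the two distributive laws, $\alpha\wedge\top=\alpha$, $\alpha\vee\bot=\alpha$; - $\alpha\,\mathsf W\,\beta=\mathsf G\alpha\vee(\alpha\,\mathsf U\,\beta)$; $\mathsf X(\alpha*\beta)=\mathsf X\alpha*\mathsf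 X\beta$; $\mathsf{XM}\alpha=\mathsf M\alpha$; - $\mathsf{FF}\alpha=\mathsf F\alpha$; $\mathsf{FG}\alpha=\mathsf G\alpha$; $\mathsf F(\alpha\,\mathsf U\,\beta)=\mathsf F\beta$; $\mathsf F(\alpha\vee\beta)=\mathsf F\alpha\vee\mathsf F\beta$; $\mathsf F(\alpha\wedge\mathsf M\beta)=\mathsf F\alpha\wedge\mathsf M\beta$; - $\mathsf G\top=\top$; $\mathsf{GG}\alpha=\mathsf G\alpha$; $\mathsf{GF}\alpha=\mathsf F\alpha$; $\mathsf G(\alpha\,\mathsf U\,\beta)=\mathsf G(\alpha\vee\beta)\wedge\mathsf F\beta$; $\mathsf G(\alpha\wedge\beta)=\mathsf G\alpha\wedge\mathsf G\beta$; $\mathsf G(\alpha\vee\mathsf M\beta)=\mathsf G\alpha\vee\mathsf M\beta$; - $\alpha\,\mathsf U\,(\beta\vee\gamma)=(\alpha\,\mathsf U\,\beta)\vee(\alpha\,\mathsf U\,\gamma)$; $\alpha\,\mathsf U\,(\beta*\mathsf M\gamma)=(\alpha\,\mathsf U\,\beta)*\mathsf M\gamma$; $(\alpha\wedge\beta)\,\mathsf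 U\,\gamma=(\alpha\,\mathsf U\,\gamma)\wedge(\beta\,\mathsf U\,\gamma)$; $(\alpha\vee\mathsf M\beta)\,\mathsf U\,\gamma=(\mathsf M\beta\wedge\mathsf F\gamma)\vee(\alpha\,\mathsf U\,\gamma)$; $(\alpha\wedge\mathsf M\beta)\,\mathsf U\,\gamma=(\mathsf M\beta\wedge(\alpha\,\mathsf U\,\gamma))\vee\gamma$. (These equations hold on periodic words, not on all words; item 1 asserts equivalence on all words.) -/

import Mathlib

/-- Formulas of linear temporal logic in positive normal form over the atomic propositions `AP`. -/
inductive LTL (AP : Type*) : Type _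
  | atom : AP → LTL AP
  | natom : AP → LTL AP
  | conj : LTL AP → LTL AP → LTL AP
  | disj : LTL AP → LTL AP → LTL AP
  | next : LTL AP → LTL AP
  | untl : LTL AP → LTL AP → LTL AP
  | wuntl : LTL AP → LTL AP → LTL AP

namespace LTL

/-- Satisfaction of a formula by an infinite word over the alphabet `2^AP`. -/
def Sat {AP : Type*} : Stream' (Set AP) → LTL AP → Prop
  | ρ, atom a => a ∈ ρ.get 0
  | ρ, natom a => a ∉ ρ.get 0
  | ρ, conj φ ψ => Sat ρ φ ∧ Sat ρ ψ
  | ρ, disj φ ψ => Sat ρ φ ∨ Sat ρ ψ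
  | ρ, next φ => Sat (ρ.drop 1) φ
  | ρ, untl φ ψ => ∃ i, Sat (ρ.drop i) ψ ∧ ∀ j < i, Sat (ρ.drop j) φ
  | ρ, wuntl φ ψ =>
      (∀ i, Sat (ρ.drop i) φ) ∨ ∃ i, Sat (ρ.drop i) ψ ∧ ∀ j < i, Sat (ρ.drop j) φ

/-- Semantic equivalence: the same infinite words satisfy both formulas. -/
def Equivalent {AP : Type*} (φ ψ : LTL AP) : Prop :=
  ∀ ρ : Stream' (Set AP), Sat ρ φ ↔ Sat ρ ψ

/-- Fairness: the satisfying words are closed under suffixes and under adding finite prefixes. -/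
def IsFair {AP : Type*} (φ : LTL AP) : Prop :=
  ∀ ρ : Stream' (Set AP), Sat ρ φ →
    (∀ i : ℕ, Sat (ρ.drop i) φ) ∧ (∀ u : List (Set AP), Sat (u ++ₛ ρ) φ)

/-- True, as the abbreviation `a ∨ ¬a` (for a designated atomic proposition `a`). -/
def tt {AP : Type*} [Inhabited AP] : LTL AP := disj (atom default) (natom default)

/-- False, as the abbreviation `a ∧ ¬a`. -/
def ff {AP : Type*} [Inhabited AP] : LTL AP := conj (atom default) (natom default)

/-- Eventually: `F φ = ⊤ U φ`. -/
def F {AP : Type*} [Inhabited AP] (φ : LTL AP) : LTL AP := untl tt φ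

/-- Always: `G φ = φ W ⊥`. -/
def G {AP : Type*} [Inhabited AP] (φ : LTL AP) : LTL AP := wuntl φ ff

/-- Finite conjunctions; the empty one is true. -/
def bigConj {AP : Type*} [Inhabited AP] : List (LTL AP) → LTL AP
  | [] => tt
  | φ :: l => conj φ (bigConj l)

/-- Finite disjunctions; the empty one is false. -/
def bigDisj {AP : Type*} [Inhabited AP] : List (LTL AP) → LTL AP
  | [] => ff
  | φ :: l => disj φ (bigDisj l)

/-- The fragment LTL(F, G). -/
inductive IsFG {AP : Type*} [Inhabited AP] : LTL AP → Prop
  | atom (a : AP) : IsFG (atom a)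
  | natom (a : AP) : IsFG (natom a)
  | conj {φ ψ : LTL AP} : IsFG φ → IsFG ψ → IsFG (conj φ ψ)
  | disj {φ ψ : LTL AP} : IsFG φ → IsFG ψ → IsFG (disj φ ψ)
  | ev {φ : LTL AP} : IsFG φ → IsFG (F φ)
  | alw {φ : LTL AP} : IsFG φ → IsFG (G φ)

/-- The (co-safety) fragment LTL(U, X). -/
inductive IsUX {AP : Type*} : LTL AP → Prop
  | atom (a : AP) : IsUX (atom a)
  | natom (a : AP) : IsUX (natom a)
  | conj {φ ψ : LTL AP} : IsUX φ → IsUX ψ → IsUX (conj φ ψ)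
  | disj {φ ψ : LTL AP} : IsUX φ → IsUX ψ → IsUX (disj φ ψ)
  | next {φ : LTL AP} : IsUX φ → IsUX (next φ)
  | untl {φ ψ : LTL AP} : IsUX φ → IsUX ψ → IsUX (untl φ ψ)

/-- The set of subformulas of a formula, the formula itself included. -/
def subformulas {AP : Type*} : LTL AP → Set (LTL AP)
  | atom a => {atom a}
  | natom a => {natom a}
  | conj φ ψ => {conj φ ψ} ∪ (subformulas φ ∪ subformulas ψ)
  | disj φ ψ => {disj φ ψ} ∪ (subformulas φ ∪ subformulas ψ)
  | next φ => {next φ} ∪ subformulas φ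
  | untl φ ψ => {untl φ ψ} ∪ (subformulas φ ∪ subformulas ψ)
  | wuntl φ ψ => {wuntl φ ψ} ∪ (subformulas φ ∪ subformulas ψ)

/-- The modalities F and G do not occur in the formula. -/
def FGFree {AP : Type*} [Inhabited AP] (φ : LTL AP) : Prop :=
  ∀ χ : LTL AP, F χ ∉ subformulas φ ∧ G χ ∉ subformulas φ

/-- The data of one disjunct `φ₀ ∧ FG φ₁ ∧ ⋀ⱼ GF φⱼ` of a fair normal form. -/
structure FairDisjunct (AP : Type*) where
  /-- the formula `φ₀` -/
  init : LTL AP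
  /-- the formula `φ₁` -/
  persistent : LTL AP
  /-- the formulas `φⱼ`, `j ≥ 2` -/
  recurrent : List (LTL AP)

/-- The formula `φ₀ ∧ FG φ₁ ∧ ⋀ⱼ GF φⱼ`. -/
def FairDisjunct.toLTL {AP : Type*} [Inhabited AP] (d : FairDisjunct AP) : LTL AP :=
  conj d.init (conj (F (G d.persistent)) (bigConj (d.recurrent.map fun χ => G (F χ))))

/-- `φ₀` is in LTL(F, G); `φ₁` and all `φⱼ` are in LTL(U, X), and F, G do not occur in them. -/
structure FairDisjunct.IsSeparated {AP : Type*} [Inhabited AP] (d : FairDisjunct AP) : Prop where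
  init : IsFG d.init
  persistent : IsUX d.persistent ∧ FGFree d.persistent
  recurrent : ∀ χ ∈ d.recurrent, IsUX χ ∧ FGFree χ

/-- Fair normal form: a disjunction of formulas `φ₀ ∧ FG φ₁ ∧ ⋀ⱼ GF φⱼ` as above. -/
def IsFairNormalForm {AP : Type*} [Inhabited AP] (ψ : LTL AP) : Prop :=
  ∃ ds : List (FairDisjunct AP),
    (∀ d ∈ ds, d.IsSeparated) ∧ ψ = bigDisj (ds.map FairDisjunct.toLTL)

/-- The equation schemes of the syntactic transformation. -/
inductive Scheme {AP : Type*} [Inhabited AP] : LTL AP → LTL AP → Prop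
  -- the laws of `∧`, `∨`, `⊤`, `⊥`
  | conj_comm (φ ψ) : Scheme (conj φ ψ) (conj ψ φ)
  | disj_comm (φ ψ) : Scheme (disj φ ψ) (disj ψ φ)
  | conj_assoc (φ ψ χ) : Scheme (conj (conj φ ψ) χ) (conj φ (conj ψ χ))
  | disj_assoc (φ ψ χ) : Scheme (disj (disj φ ψ) χ) (disj φ (disj ψ χ))
  | conj_disj (φ ψ χ) : Scheme (conj φ (disj ψ χ)) (disj (conj φ ψ) (conj φ χ))
  | disj_conj (φ ψ χ) : Scheme (disj φ (conj ψ χ)) (conj (disj φ ψ) (disj φ χ))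
  | conj_tt (φ) : Scheme (conj φ tt) φ
  | disj_ff (φ) : Scheme (disj φ ff) φ
  -- elimination of `W`
  | wuntl_elim (φ ψ) : Scheme (wuntl φ ψ) (disj (G φ) (untl φ ψ))
  -- `X`
  | X_conj (φ ψ) : Scheme (next (conj φ ψ)) (conj (next φ) (next ψ))
  | X_disj (φ ψ) : Scheme (next (disj φ ψ)) (disj (next φ) (next ψ))
  | X_F (φ) : Scheme (next (F φ)) (F φ)
  | X_G (φ) : Scheme (next (G φ)) (G φ)
  -- `F`
  | F_F (φ) : Scheme (F (F φ)) (F φ)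
  | F_G (φ) : Scheme (F (G φ)) (G φ)
  | F_U (φ ψ) : Scheme (F (untl φ ψ)) (F ψ)
  | F_disj (φ ψ) : Scheme (F (disj φ ψ)) (disj (F φ) (F ψ))
  | F_conj_F (φ ψ) : Scheme (F (conj φ (F ψ))) (conj (F φ) (F ψ))
  | F_conj_G (φ ψ) : Scheme (F (conj φ (G ψ))) (conj (F φ) (G ψ))
  -- `G`
  | G_tt : Scheme (G tt) tt
  | G_G (φ) : Scheme (G (G φ)) (G φ)
  | G_F (φ) : Scheme (G (F φ)) (F φ)
  | G_U (φ ψ) : Scheme (G (untl φ ψ)) (conj (G (disj φ ψ)) (F ψ))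
  | G_conj (φ ψ) : Scheme (G (conj φ ψ)) (conj (G φ) (G ψ))
  | G_disj_G (φ ψ) : Scheme (G (disj φ (G ψ))) (disj (G φ) (G ψ))
  | G_disj_F (φ ψ) : Scheme (G (disj φ (F ψ))) (disj (G φ) (F ψ))
  -- second argument of `U`
  | U_disj (φ ψ χ) : Scheme (untl φ (disj ψ χ)) (disj (untl φ ψ) (untl φ χ))
  | U_conj_F (φ ψ χ) : Scheme (untl φ (conj ψ (F χ))) (conj (untl φ ψ) (F χ))
  | U_disj_F (φ ψ χ) : Scheme (untl φ (disj ψ (F χ))) (disj (untl φ ψ) (F χ))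
  | U_conj_G (φ ψ χ) : Scheme (untl φ (conj ψ (G χ))) (conj (untl φ ψ) (G χ))
  | U_disj_G (φ ψ χ) : Scheme (untl φ (disj ψ (G χ))) (disj (untl φ ψ) (G χ))
  -- first argument of `U`
  | conj_U (φ ψ χ) : Scheme (untl (conj φ ψ) χ) (conj (untl φ χ) (untl ψ χ))
  | disj_G_U (φ ψ χ) :
      Scheme (untl (disj φ (G ψ)) χ) (disj (conj (G ψ) (F χ)) (untl φ χ))
  | disj_F_U (φ ψ χ) :
      Scheme (untl (disj φ (F ψ)) χ) (disj (conj (F ψ) (F χ)) (untl φ χ))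
  | conj_F_U (φ ψ χ) :
      Scheme (untl (conj φ (F ψ)) χ) (disj (conj (F ψ) (untl φ χ)) χ)
  | conj_G_U (φ ψ χ) :
      Scheme (untl (conj φ (G ψ)) χ) (disj (conj (G ψ) (untl φ χ)) χ)

/-- One rewriting step: one occurrence of a subformula that is one side of an instance of a scheme
is replaced by the other side. -/
inductive Step {AP : Type*} [Inhabited AP] : LTL AP → LTL AP → Prop
  | lr {φ ψ : LTL AP} : Scheme φ ψ → Step φ ψ
  | rl {φ ψ : LTL AP} : Scheme φ ψ → Step ψ φ
  | conj_left {φ φ' : LTL AP} (ψ) : Step φ φ' → Step (conj φ ψ) (conj φ' ψ)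
  | conj_right (φ) {ψ ψ' : LTL AP} : Step ψ ψ' → Step (conj φ ψ) (conj φ ψ')
  | disj_left {φ φ' : LTL AP} (ψ) : Step φ φ' → Step (disj φ ψ) (disj φ' ψ)
  | disj_right (φ) {ψ ψ' : LTL AP} : Step ψ ψ' → Step (disj φ ψ) (disj φ ψ')
  | next {φ φ' : LTL AP} : Step φ φ' → Step (next φ) (next φ')
  | untl_left {φ φ' : LTL AP} (ψ) : Step φ φ' → Step (untl φ ψ) (untl φ' ψ)
  | untl_right (φ) {ψ ψ' : LTL AP} : Step ψ ψ' → Step (untl φ ψ) (untl φ ψ')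
  | wuntl_left {φ φ' : LTL AP} (ψ) : Step φ φ' → Step (wuntl φ ψ) (wuntl φ' ψ)
  | wuntl_right (φ) {ψ ψ' : LTL AP} : Step ψ ψ' → Step (wuntl φ ψ) (wuntl φ ψ')

/-- Syntactic transformation of one formula into another: finitely many rewriting steps. -/
def Rewrites {AP : Type*} [Inhabited AP] : LTL AP → LTL AP → Prop :=
  Relation.ReflTransGen Step

end LTL

/-! On a periodic word every position recurs, so the truth of `F α` or `G α` does not depend on the
position. Such a formula acts as a constant inside the scope of any temporal operator, which is what
makes the equations sound there and lets modalities be pulled outwards.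

Syntactically, every formula rewrites to a positive Boolean combination of pure formulas (LTL(U, X)
without `F`) and of formulas `F π`, `G π` with `π` pure (`reduces_isBasic`). An outer `G` absorbs
the remaining pure parts (`Reduces.alw`), so `G (F φ)` becomes a Boolean combination of modal
formulas alone. Since `F π` and `GF π`, as well as `G π` and `FG π`, are interchangeable under the
equations, a disjunctive normal form of this combination is a fair normal form, with every `φ₀`
equal to `tt`.

The rewriting preserves truth on periodic words only (`Rewrites.sat_iff`). Both `φ`, by fairness,
and the result, by its shape, are invariant under passing to suffixes. A pigeonhole argument on
subformulas yields, for any word, a periodic word on which both formulas keep their truth values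
(`exists_isPeriodic_sat_iff`); hence agreement on periodic words is agreement everywhere. -/

namespace LTL

/-! ### Rewriting as an equivalence relation and a congruence -/

section Rewriting

variable {AP : Type*} [Inhabited AP] {φ φ' ψ ψ' χ : LTL AP}

theorem Step.symm (h : Step φ ψ) : Step ψ φ := by
  induction h with
  | lr h => exact .rl h
  | rl h => exact .lr h
  | conj_left _ _ ih => exact .conj_left _ ih
  | conj_right _ _ ih => exact .conj_right _ ih
  | disj_left _ _ ih => exact .disj_left _ ih
  | disj_right _ _ ih => exact .disj_right _ ih
  | next _ ih => exact .next ih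
  | untl_left _ _ ih => exact .untl_left _ ih
  | untl_right _ _ ih => exact .untl_right _ ih
  | wuntl_left _ _ ih => exact .wuntl_left _ ih
  | wuntl_right _ _ ih => exact .wuntl_right _ ih

namespace Rewrites

theorem refl (φ : LTL AP) : Rewrites φ φ := Relation.ReflTransGen.refl

theorem trans (h : Rewrites φ ψ) (h' : Rewrites ψ χ) : Rewrites φ χ :=
  Relation.ReflTransGen.trans h h'

theorem symm (h : Rewrites φ ψ) : Rewrites ψ φ :=
  Relation.ReflTransGen.head_induction_on (motive := fun φ _ => Rewrites ψ φ) h (refl ψ)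
    fun h' _ ih => Relation.ReflTransGen.tail ih h'.symm

theorem of_scheme (h : Scheme φ ψ) : Rewrites φ ψ := Relation.ReflTransGen.single (.lr h)

theorem lift (f : LTL AP → LTL AP) (hf : ∀ φ ψ, Step φ ψ → Step (f φ) (f ψ))
    (h : Rewrites φ ψ) : Rewrites (f φ) (f ψ) :=
  Relation.ReflTransGen.lift f hf _ _ h

theorem conj (h : Rewrites φ φ') (h' : Rewrites ψ ψ') :
    Rewrites (φ.conj ψ) (φ'.conj ψ') :=
  trans (lift (LTL.conj · ψ) (fun _ _ => Step.conj_left ψ) h)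
    (lift (LTL.conj φ') (fun _ _ => Step.conj_right φ') h')

theorem disj (h : Rewrites φ φ') (h' : Rewrites ψ ψ') :
    Rewrites (φ.disj ψ) (φ'.disj ψ') :=
  trans (lift (LTL.disj · ψ) (fun _ _ => Step.disj_left ψ) h)
    (lift (LTL.disj φ') (fun _ _ => Step.disj_right φ') h')

theorem next (h : Rewrites φ φ') : Rewrites φ.next φ'.next :=
  lift LTL.next (fun _ _ => Step.next) h

theorem untl (h : Rewrites φ φ') (h' : Rewrites ψ ψ') :
    Rewrites (φ.untl ψ) (φ'.untl ψ') :=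
  trans (lift (LTL.untl · ψ) (fun _ _ => Step.untl_left ψ) h)
    (lift (LTL.untl φ') (fun _ _ => Step.untl_right φ') h')

theorem alw (h : Rewrites φ φ') : Rewrites (G φ) (G φ') :=
  lift (LTL.wuntl · ff) (fun _ _ => Step.wuntl_left ff) h

theorem conj_comm (φ ψ : LTL AP) : Rewrites (φ.conj ψ) (ψ.conj φ) := of_scheme (.conj_comm _ _)

theorem disj_comm (φ ψ : LTL AP) : Rewrites (φ.disj ψ) (ψ.disj φ) := of_scheme (.disj_comm _ _)

theorem conj_assoc (φ ψ χ : LTL AP) :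
    Rewrites ((φ.conj ψ).conj χ) (φ.conj (ψ.conj χ)) := of_scheme (.conj_assoc _ _ _)

theorem disj_assoc (φ ψ χ : LTL AP) :
    Rewrites ((φ.disj ψ).disj χ) (φ.disj (ψ.disj χ)) := of_scheme (.disj_assoc _ _ _)

theorem conj_right_comm (φ ψ χ : LTL AP) :
    Rewrites ((φ.conj ψ).conj χ) ((φ.conj χ).conj ψ) :=
  (conj_assoc _ _ _).trans (((refl φ).conj (conj_comm _ _)).trans (conj_assoc _ _ _).symm)

theorem disj_right_comm (φ ψ χ : LTL AP) :
    Rewrites ((φ.disj ψ).disj χ) ((φ.disj χ).disj ψ) :=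
  (disj_assoc _ _ _).trans (((refl φ).disj (disj_comm _ _)).trans (disj_assoc _ _ _).symm)

theorem conj_conj_conj_comm (φ ψ φ' ψ' : LTL AP) :
    Rewrites ((φ.conj ψ).conj (φ'.conj ψ')) ((φ.conj φ').conj (ψ.conj ψ')) :=
  (conj_assoc _ _ _).symm.trans
    (((conj_right_comm _ _ _).conj (refl ψ')).trans (conj_assoc _ _ _))

theorem conj_disj (φ ψ χ : LTL AP) :
    Rewrites (φ.conj (ψ.disj χ)) ((φ.conj ψ).disj (φ.conj χ)) := of_scheme (.conj_disj _ _ _)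

theorem disj_conj (φ ψ χ : LTL AP) :
    Rewrites (φ.disj (ψ.conj χ)) ((φ.disj ψ).conj (φ.disj χ)) := of_scheme (.disj_conj _ _ _)

theorem disj_conj_right (φ ψ χ : LTL AP) :
    Rewrites ((φ.disj ψ).conj χ) ((φ.conj χ).disj (ψ.conj χ)) :=
  (conj_comm _ _).trans ((conj_disj _ _ _).trans ((conj_comm _ _).disj (conj_comm _ _)))

theorem conj_disj_right (φ ψ χ : LTL AP) :
    Rewrites ((φ.conj ψ).disj χ) ((φ.disj χ).conj (ψ.disj χ)) :=
  (disj_comm _ _).trans ((disj_conj _ _ _).trans ((disj_comm _ _).conj (disj_comm _ _)))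

theorem conj_tt (φ : LTL AP) : Rewrites (φ.conj tt) φ := of_scheme (.conj_tt _)

theorem disj_ff (φ : LTL AP) : Rewrites (φ.disj ff) φ := of_scheme (.disj_ff _)

theorem tt_conj (φ : LTL AP) : Rewrites (tt.conj φ) φ := (conj_comm _ _).trans (conj_tt φ)

theorem ff_disj (φ : LTL AP) : Rewrites (ff.disj φ) φ := (disj_comm _ _).trans (disj_ff φ)

end Rewrites

/-! ### Separation into pure and modal formulas -/

/-- Formulas of LTL(U, X) without occurrences of `F`. -/
inductive IsPure : LTL AP → Prop
  | atom (a : AP) : IsPure (atom a)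
  | natom (a : AP) : IsPure (natom a)
  | conj {φ ψ : LTL AP} : IsPure φ → IsPure ψ → IsPure (conj φ ψ)
  | disj {φ ψ : LTL AP} : IsPure φ → IsPure ψ → IsPure (disj φ ψ)
  | next {φ : LTL AP} : IsPure φ → IsPure (next φ)
  | untl {φ ψ : LTL AP} : φ ≠ tt → IsPure φ → IsPure ψ → IsPure (untl φ ψ)

theorem isPure_tt : IsPure (tt : LTL AP) := .disj (.atom _) (.natom _)

theorem isPure_ff : IsPure (ff : LTL AP) := .conj (.atom _) (.natom _)

theorem IsPure.isUX (h : IsPure φ) : IsUX φ := by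
  induction h with
  | atom a => exact .atom a
  | natom a => exact .natom a
  | conj _ _ ih ih' => exact .conj ih ih'
  | disj _ _ ih ih' => exact .disj ih ih'
  | next _ ih => exact .next ih
  | untl _ _ _ ih ih' => exact .untl ih ih'

theorem IsPure.fgFree (h : IsPure φ) : FGFree φ := by
  unfold FGFree F G
  induction h with
  | atom a => simp [subformulas]
  | natom a => simp [subformulas]
  | conj _ _ ih ih' => intro χ; simp [subformulas, ih χ, ih' χ]
  | disj _ _ ih ih' => intro χ; simp [subformulas, ih χ, ih' χ]
  | next _ ih => intro χ; simp [subformulas, ih χ]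
  | untl h _ _ ih ih' => intro χ; simp [subformulas, ih χ, ih' χ, h.symm]

/-- The formulas `F π` and `G π` with `π` pure. -/
inductive IsModal : LTL AP → Prop
  | ev {φ : LTL AP} : IsPure φ → IsModal (F φ)
  | alw {φ : LTL AP} : IsPure φ → IsModal (G φ)

/-- Positive Boolean combinations of formulas satisfying `P`. -/
inductive BoolComb (P : LTL AP → Prop) : LTL AP → Prop
  | base {φ : LTL AP} : P φ → BoolComb P φ
  | conj {φ ψ : LTL AP} : BoolComb P φ → BoolComb P ψ → BoolComb P (conj φ ψ)
  | disj {φ ψ : LTL AP} : BoolComb P φ → BoolComb P ψ → BoolComb P (disj φ ψ)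

/-- Formulas that can be rewritten into a positive Boolean combination of formulas
satisfying `P`. -/
def Reduces (P : LTL AP → Prop) (φ : LTL AP) : Prop :=
  ∃ ψ, BoolComb P ψ ∧ Rewrites φ ψ

namespace Reduces

variable {P : LTL AP → Prop}

theorem base (h : P φ) : Reduces P φ := ⟨φ, .base h, .refl φ⟩

theorem of_rewrites (h : Rewrites φ ψ) : Reduces P ψ → Reduces P φ :=
  fun ⟨χ, hχ, h'⟩ => ⟨χ, hχ, h.trans h'⟩

theorem conj : Reduces P φ → Reduces P ψ → Reduces P (φ.conj ψ) :=
  fun ⟨φ', hφ, h⟩ ⟨ψ', hψ, h'⟩ => ⟨φ'.conj ψ', hφ.conj hψ, h.conj h'⟩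

theorem disj : Reduces P φ → Reduces P ψ → Reduces P (φ.disj ψ) :=
  fun ⟨φ', hφ, h⟩ ⟨ψ', hψ, h'⟩ => ⟨φ'.disj ψ', hφ.disj hψ, h.disj h'⟩

end Reduces

/-- The formulas that are pure or modal. -/
def IsBasic (φ : LTL AP) : Prop := IsPure φ ∨ IsModal φ

theorem BoolComb.isBasic (h : BoolComb IsModal φ) : BoolComb IsBasic φ := by
  induction h with
  | base h => exact .base (.inr h)
  | conj _ _ ih ih' => exact .conj ih ih'
  | disj _ _ ih ih' => exact .disj ih ih'

/-- Disjunctions of a pure formula and modal formulas. -/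
inductive DisjClause : LTL AP → Prop
  | pure {φ : LTL AP} : IsPure φ → DisjClause φ
  | disj {φ ψ : LTL AP} : DisjClause φ → IsModal ψ → DisjClause (disj φ ψ)

/-- Conjunctive normal forms. -/
inductive CNF : LTL AP → Prop
  | clause {φ : LTL AP} : DisjClause φ → CNF φ
  | conj {φ ψ : LTL AP} : CNF φ → CNF ψ → CNF (conj φ ψ)

/-- Conjunctions of a pure formula and modal formulas. -/
inductive ConjClause : LTL AP → Prop
  | pure {φ : LTL AP} : IsPure φ → ConjClause φ
  | conj {φ ψ : LTL AP} : ConjClause φ → IsModal ψ → ConjClause (conj φ ψ)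

/-- Disjunctive normal forms. -/
inductive DNF : LTL AP → Prop
  | clause {φ : LTL AP} : ConjClause φ → DNF φ
  | disj {φ ψ : LTL AP} : DNF φ → DNF ψ → DNF (disj φ ψ)

/-- The modal members are moved to the outside until two pure formulas meet; their disjunction is
again pure, so one pure member suffices. -/
theorem DisjClause.exists_disj (h : DisjClause φ) (h' : DisjClause ψ) :
    ∃ χ, DisjClause χ ∧ Rewrites (φ.disj ψ) χ := by
  induction h' with
  | pure hψ =>
    induction h with
    | pure hφ => exact ⟨_, .pure (hφ.disj hψ), .refl _⟩
    | disj _ hm ih =>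
      obtain ⟨χ, hχ, hr⟩ := ih
      exact ⟨_, hχ.disj hm, (Rewrites.disj_right_comm _ _ _).trans (hr.disj (.refl _))⟩
  | disj _ hm ih =>
    obtain ⟨χ, hχ, hr⟩ := ih
    exact ⟨_, hχ.disj hm, (Rewrites.disj_assoc _ _ _).symm.trans (hr.disj (.refl _))⟩

theorem CNF.exists_disj (h : CNF φ) (h' : CNF ψ) :
    ∃ χ, CNF χ ∧ Rewrites (φ.disj ψ) χ := by
  induction h' with
  | clause hψ =>
    induction h with
    | clause hφ =>
      obtain ⟨χ, hχ, hr⟩ := hφ.exists_disj hψ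
      exact ⟨χ, .clause hχ, hr⟩
    | conj _ _ ih ih' =>
      obtain ⟨χ, hχ, hr⟩ := ih
      obtain ⟨χ', hχ', hr'⟩ := ih'
      exact ⟨_, hχ.conj hχ', (Rewrites.conj_disj_right _ _ _).trans (hr.conj hr')⟩
  | conj _ _ ih ih' =>
    obtain ⟨χ, hχ, hr⟩ := ih
    obtain ⟨χ', hχ', hr'⟩ := ih'
    exact ⟨_, hχ.conj hχ', (Rewrites.disj_conj _ _ _).trans (hr.conj hr')⟩

theorem ConjClause.exists_conj (h : ConjClause φ) (h' : ConjClause ψ) :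
    ∃ χ, ConjClause χ ∧ Rewrites (φ.conj ψ) χ := by
  induction h' with
  | pure hψ =>
    induction h with
    | pure hφ => exact ⟨_, .pure (hφ.conj hψ), .refl _⟩
    | conj _ hm ih =>
      obtain ⟨χ, hχ, hr⟩ := ih
      exact ⟨_, hχ.conj hm, (Rewrites.conj_right_comm _ _ _).trans (hr.conj (.refl _))⟩
  | conj _ hm ih =>
    obtain ⟨χ, hχ, hr⟩ := ih
    exact ⟨_, hχ.conj hm, (Rewrites.conj_assoc _ _ _).symm.trans (hr.conj (.refl _))⟩

theorem DNF.exists_conj (h : DNF φ) (h' : DNF ψ) :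
    ∃ χ, DNF χ ∧ Rewrites (φ.conj ψ) χ := by
  induction h' with
  | clause hψ =>
    induction h with
    | clause hφ =>
      obtain ⟨χ, hχ, hr⟩ := hφ.exists_conj hψ
      exact ⟨χ, .clause hχ, hr⟩
    | disj _ _ ih ih' =>
      obtain ⟨χ, hχ, hr⟩ := ih
      obtain ⟨χ', hχ', hr'⟩ := ih'
      exact ⟨_, hχ.disj hχ', (Rewrites.disj_conj_right _ _ _).trans (hr.disj hr')⟩
  | disj _ _ ih ih' =>
    obtain ⟨χ, hχ, hr⟩ := ih
    obtain ⟨χ', hχ', hr'⟩ := ih'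
    exact ⟨_, hχ.disj hχ', (Rewrites.conj_disj _ _ _).trans (hr.disj hr')⟩

theorem BoolComb.exists_cnf (h : BoolComb IsBasic φ) : ∃ χ, CNF χ ∧ Rewrites φ χ := by
  induction h with
  | base h =>
    rcases h with h | h
    · exact ⟨_, .clause (.pure h), .refl _⟩
    -- A clause must contain a pure member; for a lone modal formula the neutral `ff` serves.
    · exact ⟨_, .clause (.disj (.pure isPure_ff) h), (Rewrites.ff_disj _).symm⟩
  | conj _ _ ih ih' =>
    obtain ⟨χ, hχ, hr⟩ := ih
    obtain ⟨χ', hχ', hr'⟩ := ih'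
    exact ⟨_, hχ.conj hχ', hr.conj hr'⟩
  | disj _ _ ih ih' =>
    obtain ⟨χ, hχ, hr⟩ := ih
    obtain ⟨χ', hχ', hr'⟩ := ih'
    obtain ⟨χ'', h, hr''⟩ := hχ.exists_disj hχ'
    exact ⟨_, h, (hr.disj hr').trans hr''⟩

theorem BoolComb.exists_dnf (h : BoolComb IsBasic φ) : ∃ χ, DNF χ ∧ Rewrites φ χ := by
  induction h with
  | base h =>
    rcases h with h | h
    · exact ⟨_, .clause (.pure h), .refl _⟩
    · exact ⟨_, .clause (.conj (.pure isPure_tt) h), (Rewrites.tt_conj _).symm⟩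
  | disj _ _ ih ih' =>
    obtain ⟨χ, hχ, hr⟩ := ih
    obtain ⟨χ', hχ', hr'⟩ := ih'
    exact ⟨_, hχ.disj hχ', hr.disj hr'⟩
  | conj _ _ ih ih' =>
    obtain ⟨χ, hχ, hr⟩ := ih
    obtain ⟨χ', hχ', hr'⟩ := ih'
    obtain ⟨χ'', h, hr''⟩ := hχ.exists_conj hχ'
    exact ⟨_, h, (hr.conj hr').trans hr''⟩

/-- `G` distributes over the conjunctions of a conjunctive normal form, and modal members leave each
clause. Only the pure member stays under `G`, so no pure formula remains at top level. -/
theorem Reduces.alw (h : Reduces IsBasic φ) : Reduces IsModal (G φ) := by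
  obtain ⟨φ', hφ', hr⟩ := h
  obtain ⟨χ, hχ, hr'⟩ := hφ'.exists_cnf
  refine .of_rewrites (hr.trans hr').alw ?_
  clear hr'
  induction hχ with
  | clause h =>
    induction h with
    | pure h => exact .base (.alw h)
    | disj _ hm ih =>
      refine .of_rewrites (.of_scheme ?_) (ih.disj (.base hm))
      cases hm with
      | ev _ => exact .G_disj_F _ _
      | alw _ => exact .G_disj_G _ _
  | conj _ _ ih ih' => exact .of_rewrites (.of_scheme (.G_conj _ _)) (ih.conj ih')

/-- Until distributes over conjunction in its first argument, hence the conjunctive normal form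
there. Extracting a modal member from a clause creates `F ψ`, which is modal because `ψ` is pure. -/
theorem Reduces.untl_pure (h : Reduces IsBasic φ) (hψ : IsPure ψ) :
    Reduces IsBasic (φ.untl ψ) := by
  obtain ⟨φ', hφ', hr⟩ := h
  obtain ⟨χ, hχ, hr'⟩ := hφ'.exists_cnf
  refine .of_rewrites ((hr.trans hr').untl (.refl ψ)) ?_
  clear hr'
  induction hχ with
  | clause h =>
    induction h with
    | @pure φ h =>
      -- With left argument `tt` the until is `F ψ`: modal, not pure.
      by_cases hφ : φ = tt
      · subst hφ
        exact .base (.inr (.ev hψ))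
      · exact .base (.inl (.untl hφ h hψ))
    | disj _ hm ih =>
      refine .of_rewrites (.of_scheme ?_)
        (((Reduces.base (.inr hm)).conj (.base (.inr (.ev hψ)))).disj ih)
      cases hm with
      | ev _ => exact .disj_F_U _ _ _
      | alw _ => exact .disj_G_U _ _ _
  | conj _ _ ih ih' => exact .of_rewrites (.of_scheme (.conj_U _ _ _)) (ih.conj ih')

/-- Until distributes over disjunction in its second argument, so here the disjunctive normal form
is the right one; extracting its modal conjuncts leaves a pure second argument. -/
theorem Reduces.untl (h : Reduces IsBasic φ) (h' : Reduces IsBasic ψ) :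
    Reduces IsBasic (φ.untl ψ) := by
  obtain ⟨ψ', hψ', hr⟩ := h'
  obtain ⟨χ, hχ, hr'⟩ := hψ'.exists_dnf
  refine .of_rewrites ((Rewrites.refl φ).untl (hr.trans hr')) ?_
  clear hr'
  induction hχ with
  | clause hc =>
    induction hc with
    | pure hψ => exact h.untl_pure hψ
    | conj _ hm ih =>
      refine .of_rewrites (.of_scheme ?_) (ih.conj (.base (.inr hm)))
      cases hm with
      | ev _ => exact .U_conj_F _ _ _
      | alw _ => exact .U_conj_G _ _ _
  | disj _ _ ih ih' => exact .of_rewrites (.of_scheme (.U_disj _ _ _)) (ih.disj ih')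

theorem Reduces.next (h : Reduces IsBasic φ) : Reduces IsBasic φ.next := by
  obtain ⟨φ', hφ', hr⟩ := h
  refine .of_rewrites hr.next ?_
  clear hr
  induction hφ' with
  | base h =>
    rcases h with h | h
    · exact .base (.inl h.next)
    · refine .of_rewrites (.of_scheme ?_) (.base (.inr h))
      cases h with
      | ev _ => exact .X_F _
      | alw _ => exact .X_G _
  | conj _ _ ih ih' => exact .of_rewrites (.of_scheme (.X_conj _ _)) (ih.conj ih')
  | disj _ _ ih ih' => exact .of_rewrites (.of_scheme (.X_disj _ _)) (ih.disj ih')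

theorem reduces_isBasic (φ : LTL AP) : Reduces IsBasic φ := by
  induction φ with
  | atom a => exact .base (.inl (.atom a))
  | natom a => exact .base (.inl (.natom a))
  | conj _ _ ih ih' => exact ih.conj ih'
  | disj _ _ ih ih' => exact ih.disj ih'
  | next _ ih => exact ih.next
  | untl _ _ ih ih' => exact ih.untl ih'
  | wuntl _ _ ih ih' =>
    obtain ⟨χ, hχ, hr⟩ := ih.alw
    exact .of_rewrites (.of_scheme (.wuntl_elim _ _))
      (Reduces.disj ⟨χ, hχ.isBasic, hr⟩ (ih.untl ih'))

/-! ### Assembling the fair normal form -/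

theorem bigConj_append (l l' : List (LTL AP)) :
    Rewrites ((bigConj l).conj (bigConj l')) (bigConj (l ++ l')) := by
  induction l with
  | nil => exact .tt_conj _
  | cons φ l ih => exact (Rewrites.conj_assoc _ _ _).trans ((Rewrites.refl φ).conj ih)

theorem bigDisj_append (l l' : List (LTL AP)) :
    Rewrites ((bigDisj l).disj (bigDisj l')) (bigDisj (l ++ l')) := by
  induction l with
  | nil => exact .ff_disj _
  | cons φ l ih => exact (Rewrites.disj_assoc _ _ _).trans ((Rewrites.refl φ).disj ih)

/-- The disjuncts `⊤ ∧ FG φ₁ ∧ ⋀ⱼ GF φⱼ` with pure `φ₁` and `φⱼ`. -/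
structure FairDisjunct.IsPure (d : FairDisjunct AP) : Prop where
  init : d.init = tt
  persistent : d.persistent.IsPure
  recurrent : ∀ χ ∈ d.recurrent, χ.IsPure

theorem isFG_tt : IsFG (tt : LTL AP) := .disj (.atom _) (.natom _)

theorem FairDisjunct.IsPure.isSeparated {d : FairDisjunct AP} (h : d.IsPure) :
    d.IsSeparated where
  init := h.init ▸ isFG_tt
  persistent := ⟨h.persistent.isUX, h.persistent.fgFree⟩
  recurrent χ hχ := ⟨(h.recurrent χ hχ).isUX, (h.recurrent χ hχ).fgFree⟩

/-- Nonempty disjunctions of fair disjuncts. -/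
inductive FairDNF : LTL AP → Prop
  | single {d : FairDisjunct AP} : d.IsPure → FairDNF d.toLTL
  | disj {φ ψ : LTL AP} : FairDNF φ → FairDNF ψ → FairDNF (disj φ ψ)

theorem FairDisjunct.exists_conj {d d' : FairDisjunct AP} (h : d.IsPure) (h' : d'.IsPure) :
    ∃ e : FairDisjunct AP, e.IsPure ∧ Rewrites (d.toLTL.conj d'.toLTL) e.toLTL := by
  refine ⟨⟨tt, d.persistent.conj d'.persistent, d.recurrent ++ d'.recurrent⟩,
    ⟨rfl, h.persistent.conj h'.persistent, ?_⟩, ?_⟩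
  · intro χ hχ
    rcases List.mem_append.1 hχ with hχ | hχ
    exacts [h.recurrent χ hχ, h'.recurrent χ hχ]
  · unfold FairDisjunct.toLTL
    rw [h.init, h'.init, List.map_append]
    refine (Rewrites.conj_conj_conj_comm _ _ _ _).trans ((Rewrites.conj_tt _).conj ?_)
    refine (Rewrites.conj_conj_conj_comm _ _ _ _).trans (.conj ?_ (bigConj_append _ _))
    -- The two persistent parts merge by dropping `F`, joining under one `G`, and restoring `F`.
    exact ((Rewrites.of_scheme (.F_G _)).conj (.of_scheme (.F_G _))).trans
      ((Rewrites.of_scheme (.G_conj _ _)).symm.trans (Rewrites.of_scheme (.F_G _)).symm)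

theorem FairDNF.exists_conj (h : FairDNF φ) (h' : FairDNF ψ) :
    ∃ χ, FairDNF χ ∧ Rewrites (φ.conj ψ) χ := by
  induction h' with
  | single hψ =>
    induction h with
    | single hφ =>
      obtain ⟨χ, hχ, hr⟩ := FairDisjunct.exists_conj hφ hψ
      exact ⟨_, .single hχ, hr⟩
    | disj _ _ ih ih' =>
      obtain ⟨χ, hχ, hr⟩ := ih
      obtain ⟨χ', hχ', hr'⟩ := ih'
      exact ⟨_, hχ.disj hχ', (Rewrites.disj_conj_right _ _ _).trans (hr.disj hr')⟩
  | disj _ _ ih ih' =>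
    obtain ⟨χ, hχ, hr⟩ := ih
    obtain ⟨χ', hχ', hr'⟩ := ih'
    exact ⟨_, hχ.disj hχ', (Rewrites.conj_disj _ _ _).trans (hr.disj hr')⟩

theorem IsModal.exists_fairDisjunct (h : IsModal φ) :
    ∃ d : FairDisjunct AP, d.IsPure ∧ Rewrites φ d.toLTL := by
  cases h with
  | @ev π h =>
    -- `F π` is read backwards as `GF π`; the persistent part `FG tt` rewrites to `tt`.
    refine ⟨⟨tt, tt, [π]⟩, ⟨rfl, isPure_tt, by simpa using h⟩, .symm ?_⟩
    refine (Rewrites.tt_conj _).trans ((Rewrites.conj ((Rewrites.of_scheme (.F_G _)).trans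
      (.of_scheme .G_tt)) ((Rewrites.conj_tt _).trans (.of_scheme (.G_F _)))).trans
      (.tt_conj _))
  | @alw π h =>
    refine ⟨⟨tt, π, []⟩, ⟨rfl, h, by simp⟩, .symm ?_⟩
    exact (Rewrites.tt_conj _).trans ((Rewrites.conj_tt _).trans (.of_scheme (.F_G _)))

theorem BoolComb.exists_fairDNF (h : BoolComb IsModal φ) : ∃ χ, FairDNF χ ∧ Rewrites φ χ := by
  induction h with
  | base h =>
    obtain ⟨d, hd, hr⟩ := h.exists_fairDisjunct
    exact ⟨_, .single hd, hr⟩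
  | disj _ _ ih ih' =>
    obtain ⟨χ, hχ, hr⟩ := ih
    obtain ⟨χ', hχ', hr'⟩ := ih'
    exact ⟨_, hχ.disj hχ', hr.disj hr'⟩
  | conj _ _ ih ih' =>
    obtain ⟨χ, hχ, hr⟩ := ih
    obtain ⟨χ', hχ', hr'⟩ := ih'
    obtain ⟨χ'', h, hr''⟩ := hχ.exists_conj hχ'
    exact ⟨_, h, (hr.conj hr').trans hr''⟩

theorem FairDNF.exists_bigDisj (h : FairDNF φ) : ∃ ds : List (FairDisjunct AP),
    (∀ d ∈ ds, d.IsPure) ∧ Rewrites φ (bigDisj (ds.map FairDisjunct.toLTL)) := by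
  induction h with
  | @single d h => exact ⟨[d], by simpa using h, (Rewrites.disj_ff _).symm⟩
  | disj _ _ ih ih' =>
    obtain ⟨ds, hds, hr⟩ := ih
    obtain ⟨ds', hds', hr'⟩ := ih'
    refine ⟨ds ++ ds', ?_, ?_⟩
    · intro d hd
      rcases List.mem_append.1 hd with hd | hd
      exacts [hds d hd, hds' d hd]
    · rw [List.map_append]
      exact (hr.disj hr').trans (bigDisj_append _ _)

theorem exists_rewrites_bigDisj (φ : LTL AP) : ∃ ds : List (FairDisjunct AP),
    (∀ d ∈ ds, d.IsPure) ∧ Rewrites (G φ) (bigDisj (ds.map FairDisjunct.toLTL)) := by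
  obtain ⟨μ, hμ, hr⟩ := (reduces_isBasic φ).alw
  obtain ⟨χ, hχ, hr'⟩ := hμ.exists_fairDNF
  obtain ⟨ds, hds, hr''⟩ := hχ.exists_bigDisj
  exact ⟨ds, hds, (hr.trans hr').trans hr''⟩

end Rewriting

/-! ### Suffix invariance and soundness on periodic words -/

section Semantics

variable {AP : Type*}

theorem sat_tt [Inhabited AP] (ρ : Stream' (Set AP)) : Sat ρ tt := em _

theorem not_sat_ff [Inhabited AP] (ρ : Stream' (Set AP)) : ¬ Sat ρ ff := fun h => h.2 h.1

theorem sat_F [Inhabited AP] {ρ : Stream' (Set AP)} {φ : LTL AP} :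
    Sat ρ (F φ) ↔ ∃ i, Sat (ρ.drop i) φ := by
  simp [F, Sat, sat_tt]

theorem sat_G [Inhabited AP] {ρ : Stream' (Set AP)} {φ : LTL AP} :
    Sat ρ (G φ) ↔ ∀ i, Sat (ρ.drop i) φ := by
  simp [G, Sat, not_sat_ff]

/-- Formulas whose truth does not change when passing to a suffix. -/
def SuffixInvariant (φ : LTL AP) : Prop :=
  ∀ (ρ : Stream' (Set AP)) (n : ℕ), Sat (ρ.drop n) φ ↔ Sat ρ φ

/-- Closure under suffixes gives one direction; the other prepends the removed prefix `ρ.take n`. -/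
theorem IsFair.suffixInvariant {φ : LTL AP} (h : IsFair φ) : SuffixInvariant φ := fun ρ n =>
  ⟨fun hn => by simpa [Stream'.append_take_drop] using (h _ hn).2 (ρ.take n),
    fun hρ => (h _ hρ).1 n⟩

theorem suffixInvariant_F_G [Inhabited AP] (φ : LTL AP) : SuffixInvariant (F (G φ)) := by
  intro ρ n
  simp only [sat_F, sat_G, Stream'.drop_drop]
  constructor
  · rintro ⟨i, h⟩
    exact ⟨n + i, h⟩
  · rintro ⟨i, h⟩
    exact ⟨i, fun j => by convert h (n + j) using 2; omega⟩

theorem suffixInvariant_G_F [Inhabited AP] (φ : LTL AP) : SuffixInvariant (G (F φ)) := by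
  intro ρ n
  simp only [sat_F, sat_G, Stream'.drop_drop]
  constructor
  · intro h j
    obtain ⟨i, hi⟩ := h j
    exact ⟨n + i, by convert hi using 2; omega⟩
  · intro h j
    obtain ⟨i, hi⟩ := h (n + j)
    exact ⟨i, hi⟩

theorem suffixInvariant_bigConj [Inhabited AP] {l : List (LTL AP)}
    (h : ∀ φ ∈ l, SuffixInvariant φ) : SuffixInvariant (bigConj l) := by
  induction l with
  | nil => exact fun ρ n => iff_of_true (sat_tt _) (sat_tt _)
  | cons φ l ih =>
    rw [List.forall_mem_cons] at h
    exact fun ρ n => and_congr (h.1 ρ n) (ih h.2 ρ n)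

theorem suffixInvariant_bigDisj [Inhabited AP] {l : List (LTL AP)}
    (h : ∀ φ ∈ l, SuffixInvariant φ) : SuffixInvariant (bigDisj l) := by
  induction l with
  | nil => exact fun ρ n => iff_of_false (not_sat_ff _) (not_sat_ff _)
  | cons φ l ih =>
    rw [List.forall_mem_cons] at h
    exact fun ρ n => or_congr (h.1 ρ n) (ih h.2 ρ n)

theorem FairDisjunct.IsPure.suffixInvariant [Inhabited AP] {d : FairDisjunct AP}
    (h : d.IsPure) : SuffixInvariant d.toLTL := by
  intro ρ n
  unfold FairDisjunct.toLTL
  rw [h.init]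
  refine and_congr (iff_of_true (sat_tt _) (sat_tt _))
    (and_congr (suffixInvariant_F_G _ ρ n) (suffixInvariant_bigConj ?_ ρ n))
  simpa using fun χ _ => suffixInvariant_G_F χ

/-- Periodic words. -/
def IsPeriodic (ρ : Stream' (Set AP)) : Prop := ∃ p, 0 < p ∧ ρ.drop p = ρ

theorem IsPeriodic.drop {ρ : Stream' (Set AP)} (h : IsPeriodic ρ) (n : ℕ) :
    IsPeriodic (ρ.drop n) := by
  obtain ⟨p, hp, h⟩ := h
  refine ⟨p, hp, ?_⟩
  conv_rhs => rw [← h]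
  simp [Stream'.drop_drop, add_comm]

theorem IsPeriodic.exists_drop_drop {ρ : Stream' (Set AP)} (h : IsPeriodic ρ) (n : ℕ) :
    ∃ m, (ρ.drop n).drop m = ρ := by
  obtain ⟨p, hp, h⟩ := h
  have hk : ∀ k, ρ.drop (k * p) = ρ := by
    intro k
    induction k with
    | zero => simp
    | succ k ih => rw [Nat.succ_mul, ← Stream'.drop_drop, ih, h]
  -- The total shift is then `n * p`, a multiple of the period; the subtraction is exact since `p`
  -- is positive.
  refine ⟨n * p - n, ?_⟩
  rw [Stream'.drop_drop, Nat.add_sub_cancel' (Nat.le_mul_of_pos_right n hp), hk]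

variable [Inhabited AP]

theorem IsPeriodic.sat_drop_F {ρ : Stream' (Set AP)} (h : IsPeriodic ρ) (n : ℕ) (φ : LTL AP) :
    Sat (ρ.drop n) (F φ) ↔ Sat ρ (F φ) := by
  rw [sat_F, sat_F]
  constructor
  · rintro ⟨i, hi⟩
    exact ⟨n + i, by rwa [← Stream'.drop_drop]⟩
  · rintro ⟨i, hi⟩
    obtain ⟨m, hm⟩ := h.exists_drop_drop n
    exact ⟨m + i, by rwa [← Stream'.drop_drop, hm]⟩

theorem IsPeriodic.sat_drop_G {ρ : Stream' (Set AP)} (h : IsPeriodic ρ) (n : ℕ) (φ : LTL AP) :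
    Sat (ρ.drop n) (G φ) ↔ Sat ρ (G φ) := by
  rw [sat_G, sat_G]
  constructor
  · intro hi i
    obtain ⟨m, hm⟩ := h.exists_drop_drop n
    simpa [← Stream'.drop_drop, hm] using hi (m + i)
  · intro hi i
    simpa [← Stream'.drop_drop] using hi (n + i)

/-- Once modal subformulas are known to be constant along the word, most of the modal schemes follow
by a case split on their truth value or by distributing quantifiers. -/
theorem Scheme.sat_iff {φ ψ : LTL AP} (h : Scheme φ ψ) {ρ : Stream' (Set AP)}
    (hρ : IsPeriodic ρ) : Sat ρ φ ↔ Sat ρ ψ := by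
  cases h with
  | conj_comm φ ψ => exact and_comm
  | disj_comm φ ψ => exact or_comm
  | conj_assoc φ ψ χ => exact and_assoc
  | disj_assoc φ ψ χ => exact or_assoc
  | conj_disj φ ψ χ => exact and_or_left
  | disj_conj φ ψ χ => exact or_and_left
  | conj_tt φ => exact and_iff_left (sat_tt ρ)
  | disj_ff φ => exact or_iff_left (not_sat_ff ρ)
  | wuntl_elim φ ψ => exact or_congr sat_G.symm Iff.rfl
  | X_conj φ ψ => exact Iff.rfl
  | X_disj φ ψ => exact Iff.rfl
  | X_F φ => exact hρ.sat_drop_F 1 φ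
  | X_G φ => exact hρ.sat_drop_G 1 φ
  | F_F φ => rw [sat_F]; simp [hρ.sat_drop_F]
  | F_G φ => rw [sat_F]; simp [hρ.sat_drop_G]
  | F_U φ ψ =>
    rw [sat_F, sat_F]
    constructor
    · rintro ⟨i, k, hk, -⟩
      exact ⟨i + k, by rwa [← Stream'.drop_drop]⟩
    · rintro ⟨i, hi⟩
      exact ⟨i, 0, by simpa using hi, by simp⟩
  | F_disj φ ψ => simp [sat_F, Sat, exists_or]
  | F_conj_F φ ψ => rw [sat_F]; simp [Sat, hρ.sat_drop_F]; simp [sat_F]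
  | F_conj_G φ ψ => rw [sat_F]; simp [Sat, hρ.sat_drop_G]; simp [sat_F]
  | G_tt => simp [sat_G, sat_tt]
  | G_G φ => rw [sat_G]; simp [hρ.sat_drop_G]
  | G_F φ => rw [sat_G]; simp [hρ.sat_drop_F]
  | G_U φ ψ =>
    constructor
    · intro h
      rw [sat_G] at h
      refine ⟨sat_G.2 fun i => ?_, ?_⟩
      · obtain ⟨k, hk, hj⟩ := h i
        rcases Nat.eq_zero_or_pos k with rfl | h0
        · exact .inr (by simpa using hk)
        · exact .inl (by simpa using hj 0 h0)
      · obtain ⟨k, hk, -⟩ := h 0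
        exact sat_F.2 ⟨k, by simpa using hk⟩
    · rintro ⟨hG, hF⟩
      rw [sat_G] at hG ⊢
      intro i
      classical
      -- By periodicity `ψ` occurs after every position. Before its first occurrence `ψ` fails, so
      -- the disjunction forces `φ`.
      have h := sat_F.1 ((hρ.sat_drop_F i ψ).2 hF)
      refine ⟨Nat.find h, Nat.find_spec h, fun j hj => ?_⟩
      have h' : Sat ((ρ.drop i).drop j) (φ.disj ψ) := by
        rw [Stream'.drop_drop]
        exact hG (i + j)
      exact h'.resolve_right (Nat.find_min h hj)
  | G_conj φ ψ => simp [sat_G, Sat, forall_and]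
  | G_disj_G φ ψ =>
    rw [sat_G]; simp [Sat, hρ.sat_drop_G, forall_or_right, sat_G (φ := φ)]
  | G_disj_F φ ψ =>
    rw [sat_G]; simp [Sat, hρ.sat_drop_F, forall_or_right, sat_G (φ := φ)]
  | U_disj φ ψ χ => simp only [Sat, or_and_right, exists_or]
  | U_conj_F φ ψ χ =>
    by_cases h : Sat ρ (F χ) <;> simp [Sat, hρ.sat_drop_F, h]
  | U_disj_F φ ψ χ =>
    by_cases h : Sat ρ (F χ) <;> simp [Sat, hρ.sat_drop_F, h]
    exact ⟨0, by simp⟩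
  | U_conj_G φ ψ χ =>
    by_cases h : Sat ρ (G χ) <;> simp [Sat, hρ.sat_drop_G, h]
  | U_disj_G φ ψ χ =>
    by_cases h : Sat ρ (G χ) <;> simp [Sat, hρ.sat_drop_G, h]
    exact ⟨0, by simp⟩
  | conj_U φ ψ χ =>
    constructor
    · rintro ⟨i, hi, hj⟩
      exact ⟨⟨i, hi, fun j hji => (hj j hji).1⟩, ⟨i, hi, fun j hji => (hj j hji).2⟩⟩
    · rintro ⟨⟨i, hi, hj⟩, ⟨k, hk, hj'⟩⟩
      rcases le_total i k with hik | hik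
      · exact ⟨i, hi, fun j hji => ⟨hj j hji, hj' j (hji.trans_le hik)⟩⟩
      · exact ⟨k, hk, fun j hji => ⟨hj j (hji.trans_le hik), hj' j hji⟩⟩
  | disj_G_U φ ψ χ =>
    by_cases h : Sat ρ (G ψ) <;> simp [Sat, hρ.sat_drop_G, h, sat_F]
    exact fun i hi _ => ⟨i, hi⟩
  | disj_F_U φ ψ χ =>
    by_cases h : Sat ρ (F ψ) <;> simp [Sat, hρ.sat_drop_F, h, sat_F (φ := χ)]
    exact fun i hi _ => ⟨i, hi⟩
  | conj_F_U φ ψ χ =>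
    by_cases h : Sat ρ (F ψ) <;> simp [Sat, hρ.sat_drop_F, h]
    · exact fun h => ⟨0, by simpa using h⟩
    -- If the modal conjunct is false, the left argument fails everywhere and the until must be
    -- fulfilled at once: `h0 0` says `i ≤ 0`.
    · exact ⟨fun ⟨i, hi, h0⟩ => by simpa [Nat.le_zero.1 (h0 0)] using hi,
        fun h => ⟨0, by simpa using h⟩⟩
  | conj_G_U φ ψ χ =>
    by_cases h : Sat ρ (G ψ) <;> simp [Sat, hρ.sat_drop_G, h]
    · exact fun h => ⟨0, by simpa using h⟩
    · exact ⟨fun ⟨i, hi, h0⟩ => by simpa [Nat.le_zero.1 (h0 0)] using hi,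
        fun h => ⟨0, by simpa using h⟩⟩

/-- The word is generalized because temporal operators evaluate their arguments at suffixes, which
are again periodic. -/
theorem Step.sat_iff {φ ψ : LTL AP} (h : Step φ ψ) {ρ : Stream' (Set AP)}
    (hρ : IsPeriodic ρ) : Sat ρ φ ↔ Sat ρ ψ := by
  induction h generalizing ρ with
  | lr h => exact h.sat_iff hρ
  | rl h => exact (h.sat_iff hρ).symm
  | conj_left _ _ ih => exact and_congr (ih hρ) Iff.rfl
  | conj_right _ _ ih => exact and_congr Iff.rfl (ih hρ)
  | disj_left _ _ ih => exact or_congr (ih hρ) Iff.rfl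
  | disj_right _ _ ih => exact or_congr Iff.rfl (ih hρ)
  | next _ ih => exact ih (hρ.drop 1)
  | untl_left _ _ ih => simp only [Sat, fun n => ih (hρ.drop n)]
  | untl_right _ _ ih => simp only [Sat, fun n => ih (hρ.drop n)]
  | wuntl_left _ _ ih => simp only [Sat, fun n => ih (hρ.drop n)]
  | wuntl_right _ _ ih => simp only [Sat, fun n => ih (hρ.drop n)]

theorem Rewrites.sat_iff {φ ψ : LTL AP} (h : Rewrites φ ψ) {ρ : Stream' (Set AP)}
    (hρ : IsPeriodic ρ) : Sat ρ φ ↔ Sat ρ ψ := by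
  induction h with
  | refl => exact Iff.rfl
  | tail _ h ih => exact ih.trans (h.sat_iff hρ)

end Semantics

/-! ### Reduction of arbitrary words to periodic ones -/

section Lasso

variable {AP : Type*}

theorem mem_subformulas_self (φ : LTL AP) : φ ∈ subformulas φ := by
  cases φ <;> simp [subformulas]

theorem finite_subformulas (φ : LTL AP) : (subformulas φ).Finite := by
  induction φ <;> simp_all [subformulas]

theorem sat_untl_iff (ρ : Stream' (Set AP)) (φ ψ : LTL AP) :
    Sat ρ (φ.untl ψ) ↔ Sat ρ ψ ∨ Sat ρ φ ∧ Sat (ρ.drop 1) (φ.untl ψ) := by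
  constructor
  · rintro ⟨_ | i, hi, hj⟩
    · exact .inl (by simpa using hi)
    · refine .inr ⟨by simpa using hj 0 (by omega), i, ?_, fun j hji => ?_⟩
      · simpa [Stream'.drop_drop, add_comm] using hi
      · simpa [Stream'.drop_drop, add_comm] using hj (j + 1) (by omega)
  · rintro (h | ⟨h, i, hi, hj⟩)
    · exact ⟨0, by simpa using h, by simp⟩
    · refine ⟨i + 1, by simpa [Stream'.drop_drop, add_comm] using hi, ?_⟩
      rintro (_ | j) hji
      · simpa using h
      · simpa [Stream'.drop_drop, add_comm] using hj j (by omega)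

theorem sat_wuntl_iff (ρ : Stream' (Set AP)) (φ ψ : LTL AP) :
    Sat ρ (φ.wuntl ψ) ↔ Sat ρ ψ ∨ Sat ρ φ ∧ Sat (ρ.drop 1) (φ.wuntl ψ) := by
  have h : ∀ ρ : Stream' (Set AP),
      Sat ρ (φ.wuntl ψ) ↔ (∀ i, Sat (ρ.drop i) φ) ∨ Sat ρ (φ.untl ψ) := fun _ => Iff.rfl
  have hG : (∀ i, Sat (ρ.drop i) φ) ↔ Sat ρ φ ∧ ∀ i, Sat ((ρ.drop 1).drop i) φ := by
    constructor
    · exact fun h => ⟨by simpa using h 0, fun i => by rw [Stream'.drop_drop]; exact h _⟩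
    · rintro ⟨h, h'⟩ (_ | i)
      · simpa using h
      · simpa [Stream'.drop_drop, add_comm] using h' i
  rw [h, h, sat_untl_iff, hG]
  tauto

/-- Unfolding an until operator along a sequence of positions. -/
theorem until_iff {U A B : ℕ → Prop} (step : ∀ n, U n ↔ B n ∨ A n ∧ U (n + 1))
    (ev : ∀ n, U n → ∃ k, B (n + k)) (n : ℕ) :
    U n ↔ ∃ k, B (n + k) ∧ ∀ j < k, A (n + j) := by
  constructor
  · intro h
    classical
    have hB := ev n h
    refine ⟨Nat.find hB, Nat.find_spec hB, ?_⟩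
    have key : ∀ j ≤ Nat.find hB, U (n + j) := by
      intro j
      induction j with
      | zero => exact fun _ => h
      | succ j ih =>
        intro hj
        exact (((step _).1 (ih (by omega))).resolve_left (Nat.find_min hB (by omega))).2
    exact fun j hj => (((step _).1 (key j hj.le)).resolve_left (Nat.find_min hB hj)).1
  · rintro ⟨k, hk, hj⟩
    induction k generalizing n with
    | zero => exact (step n).2 (.inl hk)
    | succ k ih =>
      refine (step n).2 (.inr ⟨hj 0 (by omega), ih (n + 1) ?_ fun j hjk => ?_⟩)
      · rwa [add_assoc, add_comm 1]
      · rw [add_assoc, add_comm 1]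
        exact hj (j + 1) (by omega)

/-- Unfolding a weak until operator along a sequence of positions. -/
theorem weakUntil_iff {U A B : ℕ → Prop} (step : ∀ n, U n ↔ B n ∨ A n ∧ U (n + 1))
    (ev : ∀ n, ¬ U n → ∃ k, ¬ A (n + k)) (n : ℕ) :
    U n ↔ (∀ k, A (n + k)) ∨ ∃ k, B (n + k) ∧ ∀ j < k, A (n + j) := by
  -- Duality: the negation of a weak until of `A`, `B` unfolds like the until of `¬ B` and `¬ A ∧ ¬
  -- B`.
  have h := until_iff (U := fun n => ¬ U n) (A := fun n => ¬ B n)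
    (B := fun n => ¬ A n ∧ ¬ B n) (fun n => by rw [step n]; tauto) (fun n hn => by
      by_contra! hc
      have key : ∀ k, ¬ U (n + k) := by
        intro k
        induction k with
        | zero => exact hn
        | succ k ih =>
          have h1 := mt (step _).2 ih
          have h2 := hc k
          rw [← add_assoc]
          tauto
      obtain ⟨k, hk⟩ := ev n hn
      exact key k ((step _).2 (.inl (hc k hk)))) n
  constructor
  · intro hU
    by_contra! hc
    obtain ⟨⟨k, hk⟩, hc⟩ := hc
    classical
    have hex : ∃ k, ¬ A (n + k) := ⟨k, hk⟩
    have hA : ∀ j < Nat.find hex, A (n + j) := fun j hj => not_not.1 (Nat.find_min hex hj)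
    have hB : ∀ j ≤ Nat.find hex, ¬ B (n + j) := fun j hj hB => by
      obtain ⟨i, hi, hi'⟩ := hc j hB
      exact hi' (hA i (by omega))
    exact h.2 ⟨Nat.find hex, ⟨Nat.find_spec hex, hB _ le_rfl⟩, fun j hj => hB j hj.le⟩ hU
  · intro hA
    by_contra hU
    obtain ⟨k, ⟨hk, hk'⟩, hj⟩ := h.1 hU
    rcases hA with hA | ⟨i, hi, hi'⟩
    · exact hk (hA k)
    · rcases lt_trichotomy i k with hik | rfl | hik
      · exact hj i hik hi
      · exact hk' hi
      · exact hk (hi' k hik)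

/-- Positions `i < j` of a word are a good loop for a formula if its subformulas do not
distinguish them and all its eventualities pending at `i` are fulfilled before `j`. -/
def IsLoop (ρ : Stream' (Set AP)) (i j : ℕ) (φ : LTL AP) : Prop :=
  (Sat (ρ.drop i) φ ↔ Sat (ρ.drop j) φ) ∧ match φ with
  | atom _ => True
  | natom _ => True
  | conj φ ψ => IsLoop ρ i j φ ∧ IsLoop ρ i j ψ
  | disj φ ψ => IsLoop ρ i j φ ∧ IsLoop ρ i j ψ
  | next φ => IsLoop ρ i j φ
  | untl φ ψ => IsLoop ρ i j φ ∧ IsLoop ρ i j ψ ∧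
      (Sat (ρ.drop i) (untl φ ψ) → ∃ k, i ≤ k ∧ k < j ∧ Sat (ρ.drop k) ψ)
  | wuntl φ ψ => IsLoop ρ i j φ ∧ IsLoop ρ i j ψ ∧
      (¬ Sat (ρ.drop i) (wuntl φ ψ) → ∃ k, i ≤ k ∧ k < j ∧ ¬ Sat (ρ.drop k) φ)

theorem IsLoop.sat_iff {ρ : Stream' (Set AP)} {i j : ℕ} {φ : LTL AP} (h : IsLoop ρ i j φ) :
    Sat (ρ.drop i) φ ↔ Sat (ρ.drop j) φ := by
  cases φ <;> exact h.1

/-- The periodic word repeating the segment of length `p` that starts at position `i`. -/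
def loopWord (ρ : Stream' (Set AP)) (i p : ℕ) : Stream' (Set AP) := fun n => ρ.get (i + n % p)

theorem isPeriodic_loopWord (ρ : Stream' (Set AP)) (i : ℕ) {p : ℕ} (hp : 0 < p) :
    IsPeriodic (loopWord ρ i p) := by
  refine ⟨p, hp, ?_⟩
  ext1 n
  rw [Stream'.get_drop]
  simp [loopWord, Stream'.get]

/-- Only the last position of the loop matters: its successor wraps around to `i` instead of `i +
p`, and `h` identifies the two. -/
theorem sat_succ_mod {ρ : Stream' (Set AP)} {i p : ℕ} {φ : LTL AP} (hp : 0 < p)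
    (h : Sat (ρ.drop i) φ ↔ Sat (ρ.drop (i + p)) φ) (n : ℕ) :
    Sat (ρ.drop (i + (n + 1) % p)) φ ↔ Sat ((ρ.drop (i + n % p)).drop 1) φ := by
  rw [Stream'.drop_drop]
  rcases Nat.lt_or_ge (n % p + 1) p with hlt | hge
  · rw [← Nat.mod_add_mod, Nat.mod_eq_of_lt hlt, add_assoc]
  · have heq : n % p + 1 = p := le_antisymm (Nat.mod_lt n hp) hge
    rw [← Nat.mod_add_mod, add_assoc, heq, Nat.mod_self, add_zero, h]

theorem exists_mod_eq (n k p : ℕ) (hp : 0 < p) : ∃ m, (n + m) % p = k % p := by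
  refine ⟨n * p - n + k, ?_⟩
  rw [← add_assoc, Nat.add_sub_cancel' (Nat.le_mul_of_pos_right n hp), add_comm]
  simp

/-- The truth values of `ρ` read around the loop obey the one-step unfolding laws, by
`sat_succ_mod`. These laws determine until and weak until once no eventuality is postponed forever,
which the loop condition rules out. -/
theorem sat_loopWord {ρ : Stream' (Set AP)} {i p : ℕ} (hp : 0 < p) {φ : LTL AP}
    (h : IsLoop ρ i (i + p) φ) (n : ℕ) :
    Sat ((loopWord ρ i p).drop n) φ ↔ Sat (ρ.drop (i + n % p)) φ := by
  induction φ generalizing n with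
  | atom a => simp [Sat, Stream'.get_drop]; simp [loopWord, Stream'.get]
  | natom a => simp [Sat, Stream'.get_drop]; simp [loopWord, Stream'.get]
  | conj φ ψ ih ih' => exact and_congr (ih h.2.1 n) (ih' h.2.2 n)
  | disj φ ψ ih ih' => exact or_congr (ih h.2.1 n) (ih' h.2.2 n)
  | next φ ih =>
    simp only [Sat]
    rw [Stream'.drop_drop, ih h.2, sat_succ_mod hp h.2.sat_iff]
  | untl φ ψ ih ih' =>
    obtain ⟨hU, hφ, hψ, hev⟩ := h
    have step := fun n => (sat_untl_iff (ρ.drop (i + n % p)) φ ψ).trans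
      (by rw [← sat_succ_mod hp hU n])
    rw [until_iff (U := fun n => Sat (ρ.drop (i + n % p)) (φ.untl ψ)) step ?_ n]
    · simp only [Sat, Stream'.drop_drop, ih hφ, ih' hψ]
    · intro n hn
      by_contra! hc
      have key : ∀ k, Sat (ρ.drop (i + (n + k) % p)) (φ.untl ψ) := by
        intro k
        induction k with
        | zero => exact hn
        | succ k ih => exact (((step _).1 ih).resolve_left (hc k)).2
      -- An unfulfilled until would still be pending on the next return to the start of the loop.
      -- There the loop condition supplies a position `k` satisfying `ψ`, which is visited again
      -- after `n`.
      obtain ⟨m, hm⟩ := exists_mod_eq n 0 p hp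
      obtain ⟨k, hik, hkp, hk⟩ := hev (by simpa [hm] using key m)
      obtain ⟨m, hm⟩ := exists_mod_eq n (k - i) p hp
      refine hc m ?_
      rwa [hm, Nat.mod_eq_of_lt (by omega), Nat.add_sub_cancel' hik]
  | wuntl φ ψ ih ih' =>
    obtain ⟨hU, hφ, hψ, hev⟩ := h
    have step := fun n => (sat_wuntl_iff (ρ.drop (i + n % p)) φ ψ).trans
      (by rw [← sat_succ_mod hp hU n])
    rw [weakUntil_iff (U := fun n => Sat (ρ.drop (i + n % p)) (φ.wuntl ψ)) step ?_ n]
    · simp only [Sat, Stream'.drop_drop, ih hφ, ih' hψ]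
    · intro n hn
      by_contra! hc
      have key : ∀ k, ¬ Sat (ρ.drop (i + (n + k) % p)) (φ.wuntl ψ) := by
        intro k
        induction k with
        | zero => exact hn
        | succ k ih => exact fun h => ih ((step _).2 (.inr ⟨hc k, h⟩))
      obtain ⟨m, hm⟩ := exists_mod_eq n 0 p hp
      obtain ⟨k, hik, hkp, hk⟩ := hev (by simpa [hm] using key m)
      obtain ⟨m, hm⟩ := exists_mod_eq n (k - i) p hp
      refine hk ?_
      have := hc m
      rwa [hm, Nat.mod_eq_of_lt (by omega), Nat.add_sub_cancel' hik] at this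

/-- Subformulas that agree at two positions far enough apart form a good loop. -/
theorem eventually_isLoop (ρ : Stream' (Set AP)) (i : ℕ) (φ : LTL AP) :
    ∀ᶠ j in Filter.atTop,
      (∀ χ ∈ subformulas φ, Sat (ρ.drop i) χ ↔ Sat (ρ.drop j) χ) → IsLoop ρ i j φ := by
  induction φ with
  | atom a => exact .of_forall fun j h => ⟨h _ (mem_subformulas_self _), trivial⟩
  | natom a => exact .of_forall fun j h => ⟨h _ (mem_subformulas_self _), trivial⟩
  | conj φ ψ ih ih' =>
    filter_upwards [ih, ih'] with j hj hj' h
    exact ⟨h _ (mem_subformulas_self _), hj fun χ hχ => h χ (.inr (.inl hχ)),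
      hj' fun χ hχ => h χ (.inr (.inr hχ))⟩
  | disj φ ψ ih ih' =>
    filter_upwards [ih, ih'] with j hj hj' h
    exact ⟨h _ (mem_subformulas_self _), hj fun χ hχ => h χ (.inr (.inl hχ)),
      hj' fun χ hχ => h χ (.inr (.inr hχ))⟩
  | next φ ih =>
    filter_upwards [ih] with j hj h
    exact ⟨h _ (mem_subformulas_self _), hj fun χ hχ => h χ (.inr hχ)⟩
  | untl φ ψ ih ih' =>
    have hev : ∀ᶠ j in Filter.atTop, Sat (ρ.drop i) (φ.untl ψ) →
        ∃ k, i ≤ k ∧ k < j ∧ Sat (ρ.drop k) ψ := by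
      by_cases hU : Sat (ρ.drop i) (φ.untl ψ)
      · obtain ⟨k, hk, -⟩ := hU
        rw [Stream'.drop_drop] at hk
        filter_upwards [Filter.eventually_gt_atTop (i + k)] with j hj _
        exact ⟨i + k, by omega, hj, hk⟩
      · exact .of_forall fun j h => (hU h).elim
    filter_upwards [ih, ih', hev] with j hj hj' hev h
    exact ⟨h _ (mem_subformulas_self _), hj fun χ hχ => h χ (.inr (.inl hχ)),
      hj' fun χ hχ => h χ (.inr (.inr hχ)), hev⟩
  | wuntl φ ψ ih ih' =>
    have hev : ∀ᶠ j in Filter.atTop, ¬ Sat (ρ.drop i) (φ.wuntl ψ) →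
        ∃ k, i ≤ k ∧ k < j ∧ ¬ Sat (ρ.drop k) φ := by
      -- A weak until fails only if `φ` fails at some later or present position; any `j` beyond it
      -- will do.
      by_cases hU : ∀ k, Sat ((ρ.drop i).drop k) φ
      · exact .of_forall fun j h => (h (.inl hU)).elim
      · push Not at hU
        obtain ⟨k, hk⟩ := hU
        rw [Stream'.drop_drop] at hk
        filter_upwards [Filter.eventually_gt_atTop (i + k)] with j hj _
        exact ⟨i + k, by omega, hj, hk⟩
    filter_upwards [ih, ih', hev] with j hj hj' hev h
    exact ⟨h _ (mem_subformulas_self _), hj fun χ hχ => h χ (.inr (.inl hχ)),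
      hj' fun χ hχ => h χ (.inr (.inr hχ)), hev⟩

/-- Pigeonhole: there are finitely many sets of subformulas, so one of them is the set of true
subformulas at infinitely many positions. With `i` one of these, another can be chosen late enough
to close a good loop. -/
theorem exists_isLoop (ρ : Stream' (Set AP)) (φ : LTL AP) :
    ∃ i p, 0 < p ∧ IsLoop ρ i (i + p) φ := by
  have : Finite (𝒫 (subformulas φ)) := (finite_subformulas φ).finite_subsets
  obtain ⟨T, hT⟩ := Finite.exists_infinite_fiber
    fun n : ℕ => (⟨{χ ∈ subformulas φ | Sat (ρ.drop n) χ}, fun _ h => h.1⟩ : 𝒫 (subformulas φ))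
  rw [Set.infinite_coe_iff] at hT
  obtain ⟨i, hi⟩ := hT.nonempty
  obtain ⟨j, hj, hij, hloop⟩ := ((Nat.frequently_atTop_iff_infinite.2 hT).and_eventually
    ((Filter.eventually_gt_atTop i).and (eventually_isLoop ρ i φ))).exists
  refine ⟨i, j - i, by omega, ?_⟩
  rw [Nat.add_sub_cancel' hij.le]
  refine hloop fun χ hχ => ?_
  have h := congrArg Subtype.val (Eq.trans hi (Eq.symm hj))
  simpa [hχ] using Set.ext_iff.1 h χ

/-- Two suffix-invariant formulas have on some periodic word the truth values that they have on
a given word. -/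
theorem exists_isPeriodic_sat_iff {φ ψ : LTL AP} (hφ : SuffixInvariant φ)
    (hψ : SuffixInvariant ψ) (ρ : Stream' (Set AP)) :
    ∃ σ, IsPeriodic σ ∧ (Sat σ φ ↔ Sat ρ φ) ∧ (Sat σ ψ ↔ Sat ρ ψ) := by
  -- The conjunction serves only to obtain a single loop good for both formulas.
  obtain ⟨i, p, hp, h⟩ := exists_isLoop ρ (φ.conj ψ)
  refine ⟨_, isPeriodic_loopWord ρ i hp, ?_, ?_⟩
  · rw [← hφ ρ i]
    simpa using sat_loopWord hp h.2.1 0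
  · rw [← hψ ρ i]
    simpa using sat_loopWord hp h.2.2 0

end Lasso

end LTL

/-- Every fair formula is equivalent to a fair normal form, and that normal form is reached from
the (equivalent) formula `G F φ` by syntactic rewriting alone. -/
theorem mainTheorem2 {AP : Type*} [Inhabited AP] (φ : LTL AP) (hφ : LTL.IsFair φ) :
    ∃ ψ : LTL AP, LTL.IsFairNormalForm ψ ∧ LTL.Equivalent φ ψ ∧
      LTL.Rewrites (LTL.G (LTL.F φ)) ψ := by
  -- The outer `G` of `G (F φ)` is the one that the reduction needs.
  obtain ⟨ds, hds, hr⟩ := LTL.exists_rewrites_bigDisj (LTL.F φ)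
  refine ⟨_, ⟨ds, fun d hd => (hds d hd).isSeparated, rfl⟩, fun ρ => ?_, hr⟩
  have hinv : LTL.SuffixInvariant (LTL.bigDisj (ds.map LTL.FairDisjunct.toLTL)) := by
    refine LTL.suffixInvariant_bigDisj fun χ hχ => ?_
    obtain ⟨d, hd, rfl⟩ := List.mem_map.1 hχ
    exact (hds d hd).suffixInvariant
  obtain ⟨σ, hσ, h, h'⟩ := LTL.exists_isPeriodic_sat_iff hφ.suffixInvariant hinv ρ
  -- Rewriting may be used only after both sides have moved from `ρ` to the periodic `σ`; what is
  -- left is that `φ` and `G (F φ)` agree by fairness.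
  rw [← h, ← h', ← hr.sat_iff hσ]
  simp [LTL.sat_G, LTL.sat_F, hφ.suffixInvariant _ _]
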